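/- Let $Q=(Q,\le,\odot,1)$ be a unital semicartesian quantale: a complete lattice with an associative unital multiplication that distributes over arbitrary joins in each variable and satisfies $a\odot b\le a$ and $a\odot b\le b$ for all $a,b$. Regard $Q$ as a monoidal poset category, let $PSh(Q)=[Q^{op},\mathrm{Set}]$ carry the Day convolution tensor product $\otimes_{Day}$, and let $i:Sh(Q)\hookrightarrow PSh(Q)$ be the full subcategory of sheaves, i.e. of those presheaves $F$ such that for every family $(u_i)_{i\in I}$ in $Q$ with join $u=\bigvee_i u_i$, every family $s_i\in F(u_i)$ with $s_i|_{u_i\odot u_j}=s_j|_{u_i\odot u_j}$ for all $i,j$ has a unique $s\in F(u)$ with $s|_{u_i}=s_i$ for all $i$. A normal enrichment of a reflective embedding $\psi\dashv\varphi:D\to B$ into a monoidal closed category $B$ consists of a monoidal closed structure on $D$ and (lax) monoidal functor structures on $\psi$ and $\varphi$ such that the unit and counit of the adjunction are monoidal natural transformations and $\varphi$, with the induced closed functor structure $\varphi[X,Y]\to[\varphi X,\varphi Y]$, $\varphi^0: I\to\varphi I$, is normal, i.e. $\mathrm{Hom}_D(I,X)\to \mathrm{Hom}_B(I,\varphi X)$,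 $f\mapsto \varphi(f)\circ\varphi^0$, is bijective for every $X$. (Here a monoidal category is closed if every functor $X\otimes-$ has a right adjoint $[X,-]$.) Then: 1. if $F$ is a sheaf and $u\in Q$, then $F(u\odot -)$ is a sheaf; 2. $i$ has a left adjoint, and $PSh(Q)$ is monoidal closed; 3. for every left adjoint $a\dashv i$ (the sheafification), the reflective embedding $a\dashv i$ admits a normal enrichment. It can be chosen so that $F\otimes G=a(iF\otimes_{Day}iG)$ for all sheaves $F,G$, the canonical morphism $a(iF\otimes_{Day} iG)\to a\,i(F\otimes G)\to F\otimes G$ being the identity; in particular $Sh(Q)$ is monoidal closed with this tensor product; 4. any two normal enrichments of $a\dashv i$ agree up to monoidal isomorphism: the identity functor of $Sh(Q)$ has a strong monoidal structure from one to the other that is compatible with the monoidal structures of $a$. -/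

import Mathlib

universe v₁ v₂ u₁ u₂ u

open CategoryTheory MonoidalCategory Opposite

noncomputable section

section Closed

variable {D : Type u₁} [Category.{v₁} D] {B : Type u₂} [Category.{v₂} B]

/-- The canonical morphism `L : [Y, Z] ⟶ [[X, Y], [X, Z]]` of a monoidal closed category: the
transpose of internal composition `[X, Y] ⊗ [Y, Z] ⟶ [X, Z]`. -/
def internalL [MonoidalCategory D] [MonoidalClosed D] (X Y Z : D) :
    (ihom Y).obj Z ⟶ (ihom ((ihom X).obj Y)).obj ((ihom X).obj Z) :=
  MonoidalClosed.curry (MonoidalClosed.comp X Y Z)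

/-- The canonical isomorphism `i : X ⟶ [I, X]` of a monoidal closed category. -/
def internalI [MonoidalCategory D] [MonoidalClosed D] (X : D) : X ⟶ (ihom (𝟙_ D)).obj X :=
  MonoidalClosed.curry (λ_ X).hom

/-- A closed functor structure, in the sense of Eilenberg and Kelly, on a functor between monoidal
closed categories. -/
structure ClosedFunctor [MonoidalCategory D] [MonoidalClosed D] [MonoidalCategory B]
    [MonoidalClosed B] (φ : D ⥤ B) where
  /-- the comparison `φ[X, Y] ⟶ [φX, φY]` -/
  hat (X Y : D) : φ.obj ((ihom X).obj Y) ⟶ (ihom (φ.obj X)).obj (φ.obj Y)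
  /-- the comparison of units `I ⟶ φI` -/
  unit : 𝟙_ B ⟶ φ.obj (𝟙_ D)
  hat_natural_right (X : D) {Y Y' : D} (g : Y ⟶ Y') :
    φ.map ((ihom X).map g) ≫ hat X Y' = hat X Y ≫ (ihom (φ.obj X)).map (φ.map g)
  hat_natural_left {X X' : D} (f : X ⟶ X') (Y : D) :
    φ.map ((MonoidalClosed.pre f).app Y) ≫ hat X Y =
      hat X' Y ≫ (MonoidalClosed.pre (φ.map f)).app (φ.obj Y)
  /-- compatibility with `j : I ⟶ [X, X]` -/
  unit_id (X : D) :
    unit ≫ φ.map (MonoidalClosed.id X) ≫ hat X X = MonoidalClosed.id (φ.obj X)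
  /-- compatibility with `i : X ⟶ [I, X]` -/
  map_internalI (X : D) :
    φ.map (internalI X) ≫ hat (𝟙_ D) X ≫ (MonoidalClosed.pre unit).app (φ.obj X) =
      internalI (φ.obj X)
  /-- compatibility with `L : [Y, Z] ⟶ [[X, Y], [X, Z]]` -/
  map_internalL (X Y Z : D) :
    φ.map (internalL X Y Z) ≫ hat ((ihom X).obj Y) ((ihom X).obj Z) ≫
        (ihom (φ.obj ((ihom X).obj Y))).map (hat X Z) =
      hat Y Z ≫ internalL (φ.obj X) (φ.obj Y) (φ.obj Z) ≫
        (MonoidalClosed.pre (hat X Y)).app ((ihom (φ.obj X)).obj (φ.obj Z))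

namespace ClosedFunctor

open Functor.LaxMonoidal MonoidalClosed

variable [MonoidalCategory D] [MonoidalClosed D] [MonoidalCategory B] [MonoidalClosed B]

/-- A closed functor `φ` is normal if it commutes with the underlying-set functors `Hom(I, -)`,
i.e. if the canonical map `Hom(I, X) → Hom(I, φX)` is bijective for every `X`. -/
def IsNormal {φ : D ⥤ B} (c : ClosedFunctor φ) : Prop :=
  ∀ X : D, Function.Bijective (fun f : 𝟙_ D ⟶ X => c.unit ≫ φ.map f)

/-- The comparison `φ[X, Y] ⟶ [φX, φY]` of a lax monoidal functor: the transpose of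
`φX ⊗ φ[X, Y] ⟶ φ(X ⊗ [X, Y]) ⟶ φY`. -/
def laxHat (φ : D ⥤ B) [φ.LaxMonoidal] (X Y : D) :
    φ.obj ((ihom X).obj Y) ⟶ (ihom (φ.obj X)).obj (φ.obj Y) :=
  curry (μ φ X ((ihom X).obj Y) ≫ φ.map ((ihom.ev X).app Y))

lemma laxHat_ev (φ : D ⥤ B) [φ.LaxMonoidal] (X Y : D) :
    φ.obj X ◁ laxHat φ X Y ≫ (ihom.ev (φ.obj X)).app (φ.obj Y) =
      μ φ X ((ihom X).obj Y) ≫ φ.map ((ihom.ev X).app Y) :=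
  whiskerLeft_curry_ihom_ev_app _ _ _

/-- The closed functor structure induced by a (lax) monoidal functor structure. -/
def ofLaxMonoidal (φ : D ⥤ B) [φ.LaxMonoidal] : ClosedFunctor φ where
  hat := laxHat φ
  unit := ε φ
  hat_natural_right X Y Y' g := by
    apply uncurry_injective
    rw [uncurry_natural_right, uncurry_eq, uncurry_eq, MonoidalCategory.whiskerLeft_comp,
      Category.assoc, laxHat_ev, laxHat_ev, μ_natural_right_assoc, Category.assoc,
      ← Functor.map_comp, ← Functor.map_comp, ihom.ev_naturality]
  hat_natural_left f Y := by
    apply uncurry_injective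
    rw [uncurry_pre_app, uncurry_eq, uncurry_eq, MonoidalCategory.whiskerLeft_comp,
      Category.assoc, laxHat_ev, laxHat_ev, μ_natural_right_assoc, μ_natural_left_assoc,
      ← Functor.map_comp, ← Functor.map_comp, id_tensor_pre_app_comp_ev]
  unit_id X := by
    apply uncurry_injective
    rw [uncurry_eq, MonoidalCategory.whiskerLeft_comp, MonoidalCategory.whiskerLeft_comp,
      Category.assoc, Category.assoc, laxHat_ev, μ_natural_right_assoc, ← Functor.map_comp,
      MonoidalClosed.id, MonoidalClosed.id, whiskerLeft_curry_ihom_ev_app, uncurry_curry]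
    exact (right_unitality φ X).symm
  map_internalI X := by
    apply uncurry_injective
    rw [internalI, internalI, uncurry_curry, ← Category.assoc, uncurry_pre_app, uncurry_eq,
      MonoidalCategory.whiskerLeft_comp, Category.assoc, laxHat_ev, μ_natural_right_assoc,
      ← Functor.map_comp, whiskerLeft_curry_ihom_ev_app]
    exact (left_unitality φ X).symm
  map_internalL X Y Z := by
    have h₁ : uncurry (φ.map (internalL X Y Z) ≫ laxHat φ ((ihom X).obj Y) ((ihom X).obj Z) ≫
        (ihom (φ.obj ((ihom X).obj Y))).map (laxHat φ X Z)) =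
        μ φ _ _ ≫ φ.map (MonoidalClosed.comp X Y Z) ≫ laxHat φ X Z := by
      rw [← Category.assoc, uncurry_natural_right, uncurry_eq, MonoidalCategory.whiskerLeft_comp,
        Category.assoc, Category.assoc, reassoc_of% laxHat_ev, μ_natural_right_assoc,
        ← Functor.map_comp_assoc, internalL, whiskerLeft_curry_ihom_ev_app]
    have h₂ : uncurry (laxHat φ Y Z ≫ internalL (φ.obj X) (φ.obj Y) (φ.obj Z) ≫
        (pre (laxHat φ X Y)).app ((ihom (φ.obj X)).obj (φ.obj Z))) =
        laxHat φ X Y ▷ _ ≫ _ ◁ laxHat φ Y Z ≫ MonoidalClosed.comp _ _ _ := by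
      rw [← Category.assoc, uncurry_pre_app, uncurry_natural_left, internalL, uncurry_curry]
    apply uncurry_injective
    rw [h₁, h₂]
    apply uncurry_injective
    simp only [uncurry_eq, MonoidalCategory.whiskerLeft_comp, Category.assoc, laxHat_ev,
      MonoidalClosed.comp, whiskerLeft_curry_ihom_ev_app, μ_natural_right_assoc,
      ← Functor.map_comp, compTranspose]
    simp only [Functor.map_comp]
    rw [associativity_inv_assoc, associator_inv_naturality_right_assoc, whisker_exchange_assoc]
    dsimp only [Functor.id_obj]
    rw [laxHat_ev, associator_inv_naturality_middle_assoc, ← comp_whiskerRight_assoc, laxHat_ev,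
      comp_whiskerRight_assoc]
    erw [μ_natural_left_assoc φ ((ihom.ev X).app Y) ((ihom Y).obj Z)]
    rfl

end ClosedFunctor

/-- A normal enrichment of an adjunction `ψ ⊣ φ : D ⥤ B`, where `B` is monoidal closed: a monoidal
closed structure on `D` and (lax) monoidal functor structures on `ψ` and `φ`, such that `φ` is a
normal closed functor and the unit and counit are monoidal natural transformations. -/
structure NormalEnrichment [MonoidalCategory B] [MonoidalClosed B] {ψ : B ⥤ D} {φ : D ⥤ B}
    (adj : ψ ⊣ φ) where
  monoidal : MonoidalCategory D
  closed : MonoidalClosed D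
  laxLeft : ψ.LaxMonoidal
  laxRight : φ.LaxMonoidal
  normal : (ClosedFunctor.ofLaxMonoidal φ).IsNormal
  unit_isMonoidal : NatTrans.IsMonoidal adj.unit
  counit_isMonoidal : NatTrans.IsMonoidal adj.counit

namespace NormalEnrichment

variable [MonoidalCategory B] [MonoidalClosed B] {ψ : B ⥤ D} {φ : D ⥤ B} {adj : ψ ⊣ φ}

/-- The tensor product of two objects of `D` in a normal enrichment. -/
def tensor (N : NormalEnrichment adj) (X Y : D) : D :=
  letI := N.monoidal
  X ⊗ Y

/-- The canonical morphism `ψ(φX ⊗ φY) ⟶ ψφ(X ⊗ Y) ⟶ X ⊗ Y` in a normal enrichment. -/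
def fromReflection (N : NormalEnrichment adj) (X Y : D) :
    ψ.obj (φ.obj X ⊗ φ.obj Y) ⟶ N.tensor X Y :=
  letI := N.monoidal
  letI := N.laxRight
  ψ.map (Functor.LaxMonoidal.μ φ X Y) ≫ adj.counit.app (X ⊗ Y)

/-- Two normal enrichments agree up to monoidal isomorphism: the identity functor of `D` carries a
strong monoidal structure from the first to the second, for which `ψ` followed by the identity is
`ψ` as a monoidal functor. -/
def Equiv (N N' : NormalEnrichment adj) : Prop :=
  ∃ M : @Functor.Monoidal D _ N.monoidal D _ N'.monoidal (𝟭 D),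
    @NatTrans.IsMonoidal B _ _ D _ N'.monoidal (ψ ⋙ 𝟭 D) ψ ψ.rightUnitor.hom
      (@Functor.LaxMonoidal.comp B _ _ D _ N.monoidal D _ N'.monoidal ψ (𝟭 D) N.laxLeft
        M.toLaxMonoidal) N'.laxLeft

end NormalEnrichment

end Closed

section Quantale

/-- A quantale is semicartesian if `a ⊙ b ≤ a` and `a ⊙ b ≤ b` for all `a`, `b`. -/
class IsSemicartesian (Q : Type u) [Mul Q] [LE Q] : Prop where
  mul_le_left (a b : Q) : a * b ≤ a
  mul_le_right (a b : Q) : a * b ≤ b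

variable (Q : Type u) [Monoid Q] [CompleteLattice Q] [IsQuantale Q]

/-- The (strict) monoidal structure of a unital quantale, seen as a poset category. -/
instance quantaleMonoidalCategory : MonoidalCategory Q where
  tensorObj a b := a * b
  whiskerLeft a _ _ f := homOfLE (mul_le_mul_right (leOfHom f) a)
  whiskerRight f b := homOfLE (mul_le_mul_left (leOfHom f) b)
  tensorUnit := 1
  associator a b c := eqToIso (mul_assoc a b c)
  leftUnitor a := eqToIso (one_mul a)
  rightUnitor a := eqToIso (mul_one a)

/-- The category of presheaves of sets on `Q`, with the Day convolution monoidal structure. -/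
abbrev PSh : Type (u + 1) := DayFunctor Qᵒᵖ (Type u)

variable {Q}

/-- The presheaf `F(u ⊙ -)`. -/
def PSh.shift (F : PSh Q) (u : Q) : PSh Q :=
  ⟨(tensorLeft u).op ⋙ F.functor⟩

/-- The restriction `s|_v` of a section `s ∈ F(u)` along `v ≤ u`. -/
def PSh.res (F : PSh Q) {u v : Q} (h : v ≤ u) (s : F.functor.obj (op u)) : F.functor.obj (op v) :=
  F.functor.map (homOfLE h).op s

variable [IsSemicartesian Q]

/-- A family of sections `s i ∈ F(u i)` is compatible if `s i` and `s j` have the same restriction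
to `u i ⊙ u j`, for all `i`, `j`. -/
def PSh.Compatible (F : PSh Q) {I : Type u} (c : I → Q) (s : ∀ i, F.functor.obj (op (c i))) :
    Prop :=
  ∀ i j, F.res (IsSemicartesian.mul_le_left (c i) (c j)) (s i) =
    F.res (IsSemicartesian.mul_le_right (c i) (c j)) (s j)

/-- A presheaf is a sheaf if, for every cover `u = ⨆ i, c i`, every compatible family of sections
over the `c i` has a unique gluing over `u`. -/
def PSh.IsSheaf (F : PSh Q) : Prop :=
  ∀ (I : Type u) (c : I → Q) (s : ∀ i, F.functor.obj (op (c i))), F.Compatible c s →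
    ∃! t : F.functor.obj (op (⨆ i, c i)), ∀ i, F.res (le_iSup c i) t = s i

variable (Q)

/-- The full subcategory of sheaves. -/
abbrev Sh : Type (u + 1) := ObjectProperty.FullSubcategory (PSh.IsSheaf (Q := Q))

/-- The inclusion of sheaves into presheaves. -/
abbrev shInclusion : Sh Q ⥤ PSh Q := ObjectProperty.ι (PSh.IsSheaf (Q := Q))

end Quantale

end

/-!
The presheaves `F(u ⊙ -)` and `F(- ⊙ u)` are again sheaves: multiplication by `u` preserves joins,
and since `Q` is semicartesian, products of translates refine translates of products. A morphism of
presheaves `g` is inverted by sheafification iff `Hom(g, Z)` is bijective for all sheaves `Z`, and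
`Hom(X ⊗ g, Z)` is `Hom(X, -)` of the map of presheaves `u ↦ Hom(g, Z(u ⊙ -))`. Hence the inverted
morphisms are stable under tensoring, and the localization `a` is strong monoidal for a monoidal
structure on `Sh(Q)`. Internal homs into sheaves are local, which makes this structure closed, and
transporting it along `F ⊗ G ≅ a(iF ⊗ iG)` makes the comparison the identity.

Conversely, in any normal enrichment monoidality of the unit and counit forces the lax structure of
`a` to be invertible, and a strong monoidal structure on a localization determines that of its
target up to monoidal isomorphism.

Sheafification exists because sheaves are the objects local with respect to a small set of
morphisms, from presheaves presenting covers to representable ones, in the locally presentable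
category `PSh(Q)`.
-/

noncomputable section

section Adjunction

variable {A : Type u₁} [Category.{v₁} A] {B : Type u₂} [Category.{v₂} B]

lemma bijective_comp_iff_of_adjunction {L : A ⥤ B} {R : B ⥤ A} (adj : L ⊣ R) {X Y : A} (f : X ⟶ Y)
    (Z : B) : Function.Bijective (fun g : Y ⟶ R.obj Z => f ≫ g) ↔
      Function.Bijective (fun g : L.obj Y ⟶ Z => L.map f ≫ g) := by
  have : (fun g : Y ⟶ R.obj Z => f ≫ g) =
      adj.homEquiv X Z ∘ (fun g : L.obj Y ⟶ Z => L.map f ≫ g) ∘ (adj.homEquiv Y Z).symm := by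
    ext g
    simp [Adjunction.homEquiv_naturality_left]
  rw [this, Equiv.comp_bijective, Equiv.bijective_comp]

end Adjunction

section Retensor

variable {D : Type u₁} [Category.{v₁} D] [MonoidalCategory D]

/-- A copy of a monoidal category `D`, with the tensor product of `X` and `Y` replaced by the
isomorphic object `T X Y`. -/
def Retensor {T : D → D → D} (_ : ∀ X Y, X ⊗ Y ≅ T X Y) : Type u₁ := D

namespace Retensor

variable {T : D → D → D} (τ : ∀ X Y, X ⊗ Y ≅ T X Y)

instance : Category (Retensor τ) := inferInstanceAs (Category D)

/-- The identity functor, as an equivalence from `Retensor τ` to the original category. -/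
def equivalence : Retensor τ ≌ D := CategoryTheory.Equivalence.refl (C := D)

instance : MonoidalCategoryStruct (Retensor τ) where
  tensorObj X Y := T X Y
  whiskerLeft {X : D} {Y Z : D} (f : Y ⟶ Z) := (τ X Y).inv ≫ X ◁ f ≫ (τ X Z).hom
  whiskerRight {X Y : D} (f : X ⟶ Y) (Z : D) := (τ X Z).inv ≫ f ▷ Z ≫ (τ Y Z).hom
  tensorHom {X₁ Y₁ X₂ Y₂ : D} (f : X₁ ⟶ Y₁) (g : X₂ ⟶ Y₂) :=
    (τ X₁ X₂).inv ≫ MonoidalCategoryStruct.tensorHom (C := D) f g ≫ (τ Y₁ Y₂).hom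
  tensorUnit := (𝟙_ D : D)
  associator (X Y Z : D) := (((τ _ _).symm ≪≫ ((τ X Y).symm ⊗ᵢ .refl Z)) ≪≫ α_ X Y Z ≪≫
    ((.refl X ⊗ᵢ τ Y Z) ≪≫ τ _ _) : T (T X Y) Z ≅ T X (T Y Z))
  leftUnitor (X : D) :=
    (((τ _ _).symm ≪≫ ((Iso.refl (𝟙_ D)).symm ⊗ᵢ .refl X)) ≪≫ λ_ X : T (𝟙_ D) X ≅ X)
  rightUnitor (X : D) :=
    (((τ _ _).symm ≪≫ (.refl X ⊗ᵢ (Iso.refl (𝟙_ D)).symm)) ≪≫ ρ_ X : T X (𝟙_ D) ≅ X)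

/-- The comparison isomorphisms through which `Retensor τ` inherits its coherence laws. -/
def inducingFunctorData : Monoidal.InducingFunctorData (equivalence τ).functor where
  μIso (X Y : D) := τ X Y
  εIso := Iso.refl (𝟙_ D)
  whiskerLeft_eq _ _ _ _ := rfl
  whiskerRight_eq _ _ := rfl
  tensorHom_eq _ _ := rfl
  associator_eq _ _ _ := rfl
  leftUnitor_eq _ := rfl
  rightUnitor_eq _ := rfl

instance : MonoidalCategory (Retensor τ) := Monoidal.induced _ (inducingFunctorData τ)

instance : (equivalence τ).functor.Monoidal :=
  Monoidal.fromInducedMonoidal _ (inducingFunctorData τ)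

instance : (equivalence τ).inverse.Monoidal := (equivalence τ).inverseMonoidal

lemma δ_inverse (X Y : D) :
    Functor.OplaxMonoidal.δ (equivalence τ).inverse X Y =
      (equivalence τ).inverse.map (τ X Y).hom := by
  have μ_eq : Functor.LaxMonoidal.μ (equivalence τ).inverse X Y = (τ X Y).inv := by
    change 𝟙 (T X Y) ≫ (τ X Y).inv ≫ (𝟙 X ⊗ₘ 𝟙 Y) = (τ X Y).inv
    rw [id_tensorHom_id, Category.comp_id, Category.id_comp]
  have μ_δ := Functor.Monoidal.μ_δ (equivalence τ).inverse X Y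
  rw [μ_eq] at μ_δ
  exact ((Iso.inv_comp_eq (C := D) (τ X Y)).1 μ_δ).trans (Category.comp_id (τ X Y).hom)

instance [MonoidalClosed D] : MonoidalClosed (Retensor τ) :=
  MonoidalClosed.ofEquiv _ (equivalence τ).toAdjunction

end Retensor

end Retensor

section Reflection

open Functor.LaxMonoidal Functor.OplaxMonoidal

variable {D : Type u₁} [Category.{v₁} D] {B : Type u₂} [Category.{v₂} B] [MonoidalCategory B]
  {ψ : B ⥤ D} {φ : D ⥤ B} (adj : ψ ⊣ φ)

section StrongMonoidalReflector

variable [MonoidalCategory D]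

lemma bijective_ε_comp_map [ψ.Monoidal] [φ.LaxMonoidal] [adj.IsMonoidal] (X : D) :
    Function.Bijective (fun f : 𝟙_ D ⟶ X => ε φ ≫ φ.map f) := by
  have h : (fun f : 𝟙_ D ⟶ X => ε φ ≫ φ.map f) =
      (Functor.Monoidal.εIso ψ).homFromEquiv.trans (adj.homEquiv (𝟙_ B) X) := by
    ext f
    simp [Adjunction.homEquiv_unit, ← adj.unit_app_unit_comp_map_η]
  exact h ▸ Equiv.bijective _

/-- A strong monoidal structure on the left adjoint gives a normal enrichment, the right adjoint
carrying the induced lax monoidal structure. -/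
def NormalEnrichment.ofMonoidal [MonoidalClosed D] [MonoidalClosed B] [ψ.Monoidal] :
    NormalEnrichment adj :=
  letI := adj.rightAdjointLaxMonoidal
  { monoidal := inferInstance
    closed := inferInstance
    laxLeft := inferInstance
    laxRight := inferInstance
    normal := bijective_ε_comp_map adj
    unit_isMonoidal := inferInstance
    counit_isMonoidal := inferInstance }

lemma NormalEnrichment.fromReflection_ofMonoidal [MonoidalClosed D] [MonoidalClosed B] [ψ.Monoidal]
    (X Y : D) : (ofMonoidal adj).fromReflection X Y =
      δ ψ (φ.obj X) (φ.obj Y) ≫ (adj.counit.app X ⊗ₘ adj.counit.app Y) := by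
  let := adj.rightAdjointLaxMonoidal
  change ψ.map (μ φ X Y) ≫ adj.counit.app _ = _
  rw [Adjunction.rightAdjointLaxMonoidal_μ]
  exact (adj.homEquiv_counit ..).symm.trans (Equiv.symm_apply_apply _ _)

variable [φ.Full] [φ.Faithful] [ψ.Monoidal]

/-- If the reflector is strong monoidal, the tensor product of the subcategory is the reflection of
the ambient one. -/
def reflectionTensorIso (X Y : D) : ψ.obj (φ.obj X ⊗ φ.obj Y) ≅ X ⊗ Y :=
  (Functor.Monoidal.μIso ψ _ _).symm ≪≫
    (asIso (adj.counit.app X) ⊗ᵢ asIso (adj.counit.app Y))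

lemma reflectionTensorIso_hom_naturality (X : D) {Y Z : D} (f : Y ⟶ Z) :
    ψ.map (φ.obj X ◁ φ.map f) ≫ (reflectionTensorIso adj X Z).hom =
      (reflectionTensorIso adj X Y).hom ≫ X ◁ f := by
  simp only [reflectionTensorIso, Iso.trans_hom, Iso.symm_hom, Functor.Monoidal.μIso_inv,
    tensorIso_hom, asIso_hom, Category.assoc, MonoidalCategory.tensorHom_def']
  have counit_naturality : ψ.map (φ.map f) ≫ adj.counit.app Z = adj.counit.app Y ≫ f :=
    adj.counit_naturality f
  rw [← δ_natural_right_assoc, ← whisker_exchange, ← MonoidalCategory.whiskerLeft_comp_assoc,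
    counit_naturality, MonoidalCategory.whiskerLeft_comp_assoc]

lemma isIso_unit_app_ihom [MonoidalClosed B] (X : B) (Z : D) :
    IsIso (adj.unit.app ((ihom X).obj (φ.obj Z))) := by
  let W := (MorphismProperty.isomorphisms D).inverseImage ψ
  have local_φ (Y : D) : W.isLocal (φ.obj Y) := fun _ _ g hg =>
    (ObjectProperty.isLocal_iff_isIso_map adj g).2 hg _ ⟨Y, rfl⟩
  have local_ihom : W.isLocal ((ihom X).obj (φ.obj Z)) := fun _ _ g (hg : IsIso (ψ.map g)) => by
    have : W (X ◁ g) := by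
      change IsIso (ψ.map (X ◁ g))
      rw [Functor.Monoidal.map_whiskerLeft]
      infer_instance
    exact (bijective_comp_iff_of_adjunction (ihom.adjunction X) g (φ.obj Z)).2 (local_φ Z _ this)
  have unit_mem : W (adj.unit.app ((ihom X).obj (φ.obj Z))) :=
    inferInstanceAs (IsIso (ψ.map (adj.unit.app _)))
  exact (W.isLocal.isLocal_iff_isIso _ local_ihom (local_φ _)).1
    (W.le_isLocal_isLocal _ unit_mem)

/-- A reflective subcategory of a monoidal closed category is closed if its reflector is strong
monoidal: its internal hom is the reflection of the ambient one. -/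
@[reducible]
def closedOfReflective [MonoidalClosed B] : MonoidalClosed D where
  closed X :=
    { rightAdj := φ ⋙ ihom (φ.obj X) ⋙ ψ
      adj := ((ihom.adjunction (φ.obj X)).comp adj).restrictFullyFaithful
        (Functor.FullyFaithful.ofFullyFaithful φ) (Functor.FullyFaithful.id D)
        (NatIso.ofComponents (reflectionTensorIso adj X)
          (reflectionTensorIso_hom_naturality adj X))
        (have (Z : D) := isIso_unit_app_ihom adj (φ.obj X) Z
        NatIso.ofComponents (fun Z => asIso (adj.unit.app ((ihom (φ.obj X)).obj (φ.obj Z))))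
          (fun f => adj.unit.naturality ((ihom (φ.obj X)).map (φ.map f)))) }

theorem exists_normalEnrichment_of_monoidal [MonoidalClosed B] :
    ∃ (N : NormalEnrichment adj) (h : ∀ X Y : D, N.tensor X Y = ψ.obj (φ.obj X ⊗ φ.obj Y)),
      ∀ X Y : D, N.fromReflection X Y = eqToHom (h X Y).symm := by
  let := closedOfReflective adj
  let τ (X Y : D) := (reflectionTensorIso adj X Y).symm
  let adj' : ψ ⋙ (Retensor.equivalence τ).inverse ⊣ (Retensor.equivalence τ).functor ⋙ φ := adj
  let N : NormalEnrichment adj := NormalEnrichment.ofMonoidal adj'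
  refine ⟨N, fun X Y => rfl, fun X Y => ?_⟩
  refine (NormalEnrichment.fromReflection_ofMonoidal adj' X Y).trans ?_
  rw [comp_δ, Retensor.δ_inverse]
  change (δ ψ (φ.obj X) (φ.obj Y) ≫ (τ _ _).hom) ≫ (τ _ _).inv ≫
    (adj.counit.app X ⊗ₘ adj.counit.app Y) ≫ (τ X Y).hom = 𝟙 _
  rw [Category.assoc, Iso.hom_inv_id_assoc, ← Category.assoc]
  exact (τ X Y).inv_hom_id

end StrongMonoidalReflector

theorem exists_normalEnrichment_of_isMonoidal [MonoidalClosed B] [φ.Full] [φ.Faithful]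
    [((MorphismProperty.isomorphisms D).inverseImage ψ).IsMonoidal] :
    ∃ (N : NormalEnrichment adj) (h : ∀ X Y : D, N.tensor X Y = ψ.obj (φ.obj X ⊗ φ.obj Y)),
      ∀ X Y : D, N.fromReflection X Y = eqToHom (h X Y).symm := by
  have := adj.isLocalization
  let W := (MorphismProperty.isomorphisms D).inverseImage ψ
  let φ' : LocalizedMonoidal ψ W (Iso.refl (ψ.obj (𝟙_ B))) ⥤ B := φ
  have : φ'.Full := ‹φ.Full›
  have : φ'.Faithful := ‹φ.Faithful›
  exact exists_normalEnrichment_of_monoidal (φ := φ')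
    (ψ := Localization.Monoidal.toMonoidalCategory ψ W _) adj

section Uniqueness

lemma isIso_ε_of_isMonoidal [MonoidalCategory D] [ψ.LaxMonoidal] [φ.LaxMonoidal]
    [NatTrans.IsMonoidal adj.unit] [NatTrans.IsMonoidal adj.counit] : IsIso (ε ψ) := by
  have unit_ε := NatTrans.IsMonoidal.unit (τ := adj.unit)
  have counit_ε := NatTrans.IsMonoidal.unit (τ := adj.counit)
  simp only [comp_ε, id_ε, Functor.id_obj, Category.id_comp, Category.assoc] at unit_ε counit_ε
  refine ⟨ψ.map (ε φ) ≫ adj.counit.app _, counit_ε, ?_⟩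
  rw [Category.assoc, ← adj.counit_naturality, ← ψ.map_comp_assoc, ← unit_ε,
    adj.left_triangle_components]

lemma isIso_μ_of_isMonoidal [MonoidalCategory D] [ψ.LaxMonoidal] [φ.LaxMonoidal]
    [NatTrans.IsMonoidal adj.unit] [NatTrans.IsMonoidal adj.counit] (X Y : B) :
    IsIso (μ ψ X Y) := by
  have unit_μ := NatTrans.IsMonoidal.tensor (τ := adj.unit) X Y
  have counit_μ := NatTrans.IsMonoidal.tensor (τ := adj.counit) (ψ.obj X) (ψ.obj Y)
  simp only [comp_μ, id_μ, Functor.id_obj, Functor.comp_obj, Category.id_comp, Category.comp_id,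
    Category.assoc] at unit_μ counit_μ
  refine ⟨ψ.map ((adj.unit.app X ⊗ₘ adj.unit.app Y) ≫ μ φ _ _) ≫ adj.counit.app _, ?_, ?_⟩
  · rw [ψ.map_comp, Category.assoc, ← μ_natural_assoc]
    dsimp only [Functor.comp_obj, Functor.id_obj]
    rw [counit_μ, tensorHom_comp_tensorHom, adj.left_triangle_components,
      adj.left_triangle_components, id_tensorHom_id]
  · rw [Category.assoc, ← adj.counit_naturality, ← ψ.map_comp_assoc, Category.assoc, ← unit_μ,
      adj.left_triangle_components]

lemma exists_monoidal_isMonoidal_rightUnitor (W : MorphismProperty B) [W.ContainsIdentities]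
    [ψ.IsLocalization W] {M M' : MonoidalCategory D} (S : @Functor.Monoidal B _ _ D _ M ψ)
    (S' : @Functor.Monoidal B _ _ D _ M' ψ) :
    ∃ F : @Functor.Monoidal D _ M D _ M' (𝟭 D),
      @NatTrans.IsMonoidal B _ _ D _ M' (ψ ⋙ 𝟭 D) ψ ψ.rightUnitor.hom
        (@Functor.LaxMonoidal.comp B _ _ D _ M D _ M' ψ (𝟭 D) S.toLaxMonoidal F.toLaxMonoidal)
        S'.toLaxMonoidal := by
  let : Localization.Lifting ψ W ψ (𝟭 D) := ⟨ψ.rightUnitor⟩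
  exact ⟨@Localization.Monoidal.functorMonoidalOfComp _ _ _ _ _ _ _ M M' ψ W _ S (𝟭 D) ψ S' _ _,
    @Localization.Monoidal.lifting_isMonoidal _ _ _ _ _ _ _ M M' ψ W _ S (𝟭 D) ψ S' _ _⟩

namespace NormalEnrichment

variable {adj} [MonoidalClosed B]

lemma exists_monoidal_left (N : NormalEnrichment adj) :
    ∃ S : @Functor.Monoidal B _ _ D _ N.monoidal ψ, S.toLaxMonoidal = N.laxLeft := by
  let := N.monoidal
  let := N.laxLeft
  let := N.laxRight
  have := N.unit_isMonoidal
  have := N.counit_isMonoidal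
  have := isIso_ε_of_isMonoidal adj
  have := isIso_μ_of_isMonoidal adj
  exact ⟨Functor.Monoidal.ofLaxMonoidal ψ, rfl⟩

theorem equiv [φ.Full] [φ.Faithful] (N N' : NormalEnrichment adj) : N.Equiv N' := by
  obtain ⟨S, hS⟩ := N.exists_monoidal_left
  obtain ⟨S', hS'⟩ := N'.exists_monoidal_left
  have := adj.isLocalization
  unfold NormalEnrichment.Equiv
  rw [← hS, ← hS']
  exact exists_monoidal_isMonoidal_rightUnitor
    ((MorphismProperty.isomorphisms D).inverseImage ψ) S S'

end NormalEnrichment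

end Uniqueness

end Reflection

section DayConvolution

variable {C : Type u} [SmallCategory C] [MonoidalCategory C]

section Elements

variable {X Y Z : DayFunctor C (Type u)}

/-- The element `x ⊗ y` of the Day convolution of two set-valued functors. -/
def dayTmul {u v : C} (x : X.functor.obj u) (y : Y.functor.obj v) :
    (X ⊗ Y).functor.obj (u ⊗ v) :=
  (DayFunctor.η X Y).app (u, v) (x, y)

lemma map_tensorHom_dayTmul {u v u' v' : C} (f : u ⟶ u') (g : v ⟶ v') (x : X.functor.obj u)
    (y : Y.functor.obj v) :
    (X ⊗ Y).functor.map (f ⊗ₘ g) (dayTmul x y) =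
      dayTmul (X.functor.map f x) (Y.functor.map g y) :=
  (types_congr_hom
    ((DayFunctor.η X Y).naturality (X := (u, v)) (Y := (u', v')) (f, g)) (x, y)).symm

lemma map_whiskerRight_dayTmul {u u' : C} (f : u ⟶ u') (v : C) (x : X.functor.obj u)
    (y : Y.functor.obj v) :
    (X ⊗ Y).functor.map (f ▷ v) (dayTmul x y) = dayTmul (X.functor.map f x) y := by
  rw [← tensorHom_id, map_tensorHom_dayTmul, Functor.map_id_apply]

lemma map_whiskerLeft_dayTmul (u : C) {v v' : C} (g : v ⟶ v') (x : X.functor.obj u)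
    (y : Y.functor.obj v) :
    (X ⊗ Y).functor.map (u ◁ g) (dayTmul x y) = dayTmul x (Y.functor.map g y) := by
  rw [← id_tensorHom, map_tensorHom_dayTmul, Functor.map_id_apply]

lemma whiskerLeft_dayTmul (X : DayFunctor C (Type u)) (g : Y ⟶ Z) {u v : C}
    (x : X.functor.obj u) (y : Y.functor.obj v) :
    (X ◁ g).natTrans.app _ (dayTmul x y) = dayTmul x (g.natTrans.app _ y) :=
  types_congr_hom
    (LawfulDayConvolutionMonoidalCategoryStruct.convolutionExtensionUnit_comp_ι_map_whiskerLeft_app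
      (Type u) X g u v) (x, y)

lemma whiskerRight_dayTmul (f : X ⟶ Y) (Z : DayFunctor C (Type u)) {u v : C}
    (x : X.functor.obj u) (z : Z.functor.obj v) :
    (f ▷ Z).natTrans.app _ (dayTmul x z) = dayTmul (f.natTrans.app _ x) z :=
  types_congr_hom
    (LawfulDayConvolutionMonoidalCategoryStruct.convolutionExtensionUnit_comp_ι_map_whiskerRight_app
      C (Type u) f Z u v) (x, z)

lemma dayTensor_hom_ext {f g : X ⊗ Y ⟶ Z}
    (h : ∀ (u v : C) (x : X.functor.obj u) (y : Y.functor.obj v),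
      f.natTrans.app _ (dayTmul x y) = g.natTrans.app _ (dayTmul x y)) : f = g :=
  DayFunctor.tensor_hom_ext fun u v => by
    ext ⟨x, y⟩
    exact h u v x y

end Elements

/-- A natural family of maps `X(u) × Y(v) → Z(u ⊗ v)`, that is, the data of a morphism from the Day
convolution of `X` and `Y` to `Z`. -/
@[ext]
structure DayPairing (X Y Z : DayFunctor C (Type u)) where
  toFun {u v : C} : X.functor.obj u → Y.functor.obj v → Z.functor.obj (u ⊗ v)
  map_left {u u' : C} (f : u ⟶ u') {v : C} (x : X.functor.obj u) (y : Y.functor.obj v) :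
    toFun (X.functor.map f x) y = Z.functor.map (f ▷ v) (toFun x y)
  map_right {u v v' : C} (g : v ⟶ v') (x : X.functor.obj u) (y : Y.functor.obj v) :
    toFun x (Y.functor.map g y) = Z.functor.map (u ◁ g) (toFun x y)

/-- The internal hom `v ↦ Hom(X, Z(- ⊗ v))` for Day convolution, right adjoint to `X ⊗ -`. -/
def dayLeftHom (X Z : DayFunctor C (Type u)) : DayFunctor C (Type u) :=
  ⟨tensoringRight C ⋙ (Functor.whiskeringRight C C (Type u)).obj Z.functor ⋙
    (DayFunctor.equiv C (Type u)).inverse ⋙ coyoneda.obj (op X)⟩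

/-- The internal hom `u ↦ Hom(Y, Z(u ⊗ -))` for Day convolution, right adjoint to `- ⊗ Y`. -/
def dayRightHom (Y Z : DayFunctor C (Type u)) : DayFunctor C (Type u) :=
  ⟨curriedTensor C ⋙ (Functor.whiskeringRight C C (Type u)).obj Z.functor ⋙
    (DayFunctor.equiv C (Type u)).inverse ⋙ coyoneda.obj (op Y)⟩

namespace DayPairing

variable {X Y Z : DayFunctor C (Type u)}

/-- The morphism out of the Day convolution induced by a pairing. -/
def desc (b : DayPairing X Y Z) : X ⊗ Y ⟶ Z :=
  DayFunctor.tensorDesc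
    { app p := TypeCat.ofHom fun z => b.toFun z.1 z.2
      naturality p q h := by
        ext ⟨x, y⟩
        change b.toFun (X.functor.map h.1 x) (Y.functor.map h.2 y) =
          Z.functor.map (h.1 ⊗ₘ h.2) (b.toFun x y)
        rw [b.map_left, b.map_right, ← Functor.map_comp_apply, tensorHom_def'] }

lemma desc_dayTmul (b : DayPairing X Y Z) {u v : C} (x : X.functor.obj u) (y : Y.functor.obj v) :
    b.desc.natTrans.app _ (dayTmul x y) = b.toFun x y :=
  types_congr_hom (DayFunctor.η_comp_tensorDesc_app _ u v) (x, y)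

/-- The universal property of Day convolution, on elements. -/
def tensorEquiv : (X ⊗ Y ⟶ Z) ≃ DayPairing X Y Z where
  toFun f :=
    { toFun x y := f.natTrans.app _ (dayTmul x y)
      map_left g v x y := by rw [← map_whiskerRight_dayTmul, NatTrans.naturality_apply]
      map_right g x y := by rw [← map_whiskerLeft_dayTmul, NatTrans.naturality_apply] }
  invFun := desc
  left_inv _ := dayTensor_hom_ext fun _ _ => desc_dayTmul _
  right_inv b := by
    ext u v x y
    exact b.desc_dayTmul x y

/-- Currying a pairing to a morphism out of its second variable. -/
def leftHomEquiv : DayPairing X Y Z ≃ (Y ⟶ dayLeftHom X Z) where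
  toFun b :=
    { natTrans.app v := TypeCat.ofHom fun y =>
        { natTrans.app u := TypeCat.ofHom fun x => b.toFun x y
          natTrans.naturality u u' f := by ext x; exact b.map_left f x y }
      natTrans.naturality v v' g := by
        ext y
        apply DayFunctor.hom_ext
        ext u x
        exact b.map_right g x y }
  invFun f :=
    { toFun {u v} x y := (f.natTrans.app v y).natTrans.app u x
      map_left g _ x y := NatTrans.naturality_apply (f.natTrans.app _ y).natTrans g x
      map_right {u _ _} g x y :=
        congrArg (fun k => k.natTrans.app u x) (NatTrans.naturality_apply f.natTrans g y) }
  left_inv _ := rfl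
  right_inv _ := rfl

/-- Currying a pairing to a morphism out of its first variable. -/
def rightHomEquiv : DayPairing X Y Z ≃ (X ⟶ dayRightHom Y Z) where
  toFun b :=
    { natTrans.app u := TypeCat.ofHom fun x =>
        { natTrans.app v := TypeCat.ofHom fun y => b.toFun x y
          natTrans.naturality v v' g := by ext y; exact b.map_right g x y }
      natTrans.naturality u u' f := by
        ext x
        apply DayFunctor.hom_ext
        ext v y
        exact b.map_left f x y }
  invFun f :=
    { toFun {u v} x y := (f.natTrans.app u x).natTrans.app v y
      map_left {_ _} g v x y :=
        congrArg (fun k => k.natTrans.app v y) (NatTrans.naturality_apply f.natTrans g x)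
      map_right g x y := NatTrans.naturality_apply (f.natTrans.app _ x).natTrans g y }
  left_inv _ := rfl
  right_inv _ := rfl

end DayPairing

variable (X Y Z : DayFunctor C (Type u))

/-- Homs out of a Day convolution are homs into the internal hom. -/
def dayLeftHomEquiv : (X ⊗ Y ⟶ Z) ≃ (Y ⟶ dayLeftHom X Z) :=
  DayPairing.tensorEquiv.trans DayPairing.leftHomEquiv

/-- Homs out of a Day convolution are homs into the internal hom. -/
def dayRightHomEquiv : (X ⊗ Y ⟶ Z) ≃ (X ⟶ dayRightHom Y Z) :=
  DayPairing.tensorEquiv.trans DayPairing.rightHomEquiv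

variable {X Y}

lemma dayLeftHomEquiv_whiskerLeft_comp {Y' : DayFunctor C (Type u)} (g : Y ⟶ Y')
    (f : X ⊗ Y' ⟶ Z) :
    dayLeftHomEquiv X Y Z (X ◁ g ≫ f) = g ≫ dayLeftHomEquiv X Y' Z f := by
  apply DayPairing.leftHomEquiv.symm.injective
  ext u v x y
  exact congrArg (f.natTrans.app _) (whiskerLeft_dayTmul X g x y)

/-- `X ⊗ -` is left adjoint to the internal hom of `X`, for Day convolution. -/
def dayLeftHomAdjunction (X : DayFunctor C (Type u)) :
    tensorLeft X ⊣ Adjunction.rightAdjointOfEquiv (F := tensorLeft X) (dayLeftHomEquiv X)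
      (fun _ _ Z g f => dayLeftHomEquiv_whiskerLeft_comp Z g f) :=
  Adjunction.adjunctionOfEquivRight _ _

/-- Day convolution of set-valued functors is closed. -/
@[reducible]
def dayMonoidalClosed : MonoidalClosed (DayFunctor C (Type u)) where
  closed X := { rightAdj := _, adj := dayLeftHomAdjunction X }

/-- Precomposition with `f`, as a morphism of internal homs. -/
def dayLeftHomMap {X X' : DayFunctor C (Type u)} (f : X ⟶ X') (Z : DayFunctor C (Type u)) :
    dayLeftHom X' Z ⟶ dayLeftHom X Z :=
  ⟨Functor.whiskerLeft _ (Functor.whiskerLeft _ (Functor.whiskerLeft _ (coyoneda.map f.op)))⟩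

/-- Precomposition with `g`, as a morphism of internal homs. -/
def dayRightHomMap {Y Y' : DayFunctor C (Type u)} (g : Y ⟶ Y') (Z : DayFunctor C (Type u)) :
    dayRightHom Y' Z ⟶ dayRightHom Y Z :=
  ⟨Functor.whiskerLeft _ (Functor.whiskerLeft _ (Functor.whiskerLeft _ (coyoneda.map g.op)))⟩

lemma dayLeftHomEquiv_whiskerRight_comp {X' : DayFunctor C (Type u)} (g : X ⟶ X')
    (f : X' ⊗ Y ⟶ Z) :
    dayLeftHomEquiv X Y Z (g ▷ Y ≫ f) = dayLeftHomEquiv X' Y Z f ≫ dayLeftHomMap g Z := by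
  apply DayPairing.leftHomEquiv.symm.injective
  ext u v x y
  exact congrArg (f.natTrans.app _) (whiskerRight_dayTmul g Y x y)

lemma dayRightHomEquiv_whiskerLeft_comp {Y' : DayFunctor C (Type u)} (g : Y ⟶ Y')
    (f : X ⊗ Y' ⟶ Z) :
    dayRightHomEquiv X Y Z (X ◁ g ≫ f) = dayRightHomEquiv X Y' Z f ≫ dayRightHomMap g Z := by
  apply DayPairing.rightHomEquiv.symm.injective
  ext u v x y
  exact congrArg (f.natTrans.app _) (whiskerLeft_dayTmul X g x y)

lemma isIso_of_bijective_natTrans_app {f : X ⟶ Y}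
    (h : ∀ u, Function.Bijective (f.natTrans.app u)) : IsIso f := by
  have (u : C) : IsIso (f.natTrans.app u) := (isIso_iff_bijective _).2 (h u)
  have := NatIso.isIso_of_isIso_app f.natTrans
  exact inferInstanceAs (IsIso ((DayFunctor.equiv C (Type u)).inverse.map f.natTrans))

lemma isMonoidal_isLocal_of_shift (P : ObjectProperty (DayFunctor C (Type u)))
    (hl : ∀ Z, P Z → ∀ u, P ⟨tensorLeft u ⋙ Z.functor⟩)
    (hr : ∀ Z, P Z → ∀ v, P ⟨tensorRight v ⋙ Z.functor⟩) : P.isLocal.IsMonoidal where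
  whiskerLeft X Y Y' g hg Z hZ := by
    have : IsIso (dayRightHomMap g Z) :=
      isIso_of_bijective_natTrans_app fun u => hg _ (hl Z hZ u)
    refine (Equiv.comp_bijective _ (dayRightHomEquiv X Y Z)).1 ?_
    convert ((dayRightHomEquiv X Y' Z).trans (asIso (dayRightHomMap g Z)).homToEquiv).bijective
    exact funext (dayRightHomEquiv_whiskerLeft_comp Z g)
  whiskerRight {X X'} f hf Y Z hZ := by
    have : IsIso (dayLeftHomMap f Z) :=
      isIso_of_bijective_natTrans_app fun v => hf _ (hr Z hZ v)
    refine (Equiv.comp_bijective _ (dayLeftHomEquiv X Y Z)).1 ?_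
    convert ((dayLeftHomEquiv X' Y Z).trans (asIso (dayLeftHomMap f Z)).homToEquiv).bijective
    exact funext (dayLeftHomEquiv_whiskerRight_comp Z f)

end DayConvolution

section OrthogonalReflection

open Limits

theorem isRightAdjoint_ι_isLocal_ofHoms {C : Type u₁} [Category.{v₁} C] {ι : Type u₂}
    [Small.{u} ι] [IsLocallyPresentable.{u} C] {X Y : ι → C} (f : ∀ i, X i ⟶ Y i) :
    (MorphismProperty.ofHoms f).isLocal.ι.IsRightAdjoint := by
  obtain ⟨κ₀, _, _⟩ := IsLocallyPresentable.exists_cardinal.{u} C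
  choose κX hκX hX using fun i => (inferInstance : IsPresentable.{u} (X i)).exists_cardinal
  choose κY hκY hY using fun i => (inferInstance : IsPresentable.{u} (Y i)).exists_cardinal
  obtain ⟨κ, hκ, h⟩ := HasCardinalLT.exists_regular_cardinal_forall.{u}
    fun i => (max (κX i) (κY i)).ord.ToType
  have : Fact κ.IsRegular := ⟨hκ⟩
  have hle (i : ι) : max (κX i) (κY i) ≤ κ := by
    simpa only [hasCardinalLT_iff_cardinal_mk_lt, Cardinal.mk_ord_toType,
      Cardinal.lift_id] using (h i).le
  refine MorphismProperty.isRightAdjoint_ι_isLocal _ κ ?_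
  rintro _ _ _ ⟨i⟩
  exact ⟨isCardinalPresentable_of_le _ ((le_max_left _ _).trans (hle i)),
    isCardinalPresentable_of_le _ ((le_max_right _ _).trans (hle i))⟩

end OrthogonalReflection

section Sheaves

namespace PSh

variable {Q : Type u} [Monoid Q] [CompleteLattice Q] [IsQuantale Q]

lemma res_res (F : PSh Q) {u v w : Q} (h : v ≤ u) (h' : w ≤ v) (s : F.functor.obj (op u)) :
    F.res h' (F.res h s) = F.res (h'.trans h) s :=
  (Functor.map_comp_apply F.functor _ _ s).symm

lemma hom_res {F G : PSh Q} (f : F ⟶ G) {u v : Q} (h : v ≤ u) (s : F.functor.obj (op u)) :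
    f.natTrans.app (op v) (F.res h s) = G.res h (f.natTrans.app (op u) s) :=
  NatTrans.naturality_apply f.natTrans _ s

/-- The presheaf `F(- ⊙ v)`. -/
def shiftRight (F : PSh Q) (v : Q) : PSh Q :=
  ⟨(tensorRight v).op ⋙ F.functor⟩

/-- The presheaf `F(p(-))`, for a monotone map `p`. -/
def precomp (F : PSh Q) {p : Q → Q} (hp : Monotone p) : PSh Q :=
  ⟨hp.functor.op ⋙ F.functor⟩

/-- Sections over `u` are morphisms from the presheaf represented by `u`. -/
def yonedaHomEquiv (F : PSh Q) (u : Q) :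
    ((⟨yoneda.obj u⟩ : PSh Q) ⟶ F) ≃ F.functor.obj (op u) :=
  (DayFunctor.equiv _ _).fullyFaithfulFunctor.homEquiv.trans yonedaEquiv

section Cover

variable {I : Type u} (c : I → Q)

/-- The presheaf generated by one section over each member of `c`, those over `c i` and `c j` being
identified over `c i ⊙ c j`, so that morphisms out of it are compatible families. -/
def coverPresheaf : PSh Q := ⟨{
  obj w := Quot fun i j : {i // w.unop ≤ c i} => w.unop ≤ c i * c j
  map f := TypeCat.ofHom (Quot.map (fun i => ⟨i.1, (leOfHom f.unop).trans i.2⟩)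
    fun _ _ => (leOfHom f.unop).trans)
  map_id _ := by ext ⟨_⟩; rfl
  map_comp _ _ := by ext ⟨_⟩; rfl }⟩

/-- The universal section of `coverPresheaf c` over `c i`. -/
def coverSection (i : I) : (coverPresheaf c).functor.obj (op (c i)) :=
  Quot.mk _ ⟨i, le_rfl⟩

/-- The morphism from the presheaf generated by the cover `c` to the presheaf represented by its
join. -/
def coverMap : coverPresheaf c ⟶ (⟨yoneda.obj (⨆ i, c i)⟩ : PSh Q) := ⟨{
  app w := TypeCat.ofHom (Quot.lift (β := w.unop ⟶ ⨆ i, c i)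
    (fun i => homOfLE (i.2.trans (le_iSup c i.1))) fun _ _ _ => Subsingleton.elim _ _)
  naturality _ _ _ := by ext ⟨_⟩; rfl }⟩

end Cover

variable [IsSemicartesian Q]

/-- Every compatible family of sections of `F` over the members of `c` has a unique gluing over
`⨆ i, c i`: the sheaf condition for the single cover `c`. -/
def UniqueGluing (F : PSh Q) {I : Type u} (c : I → Q) : Prop :=
  ∀ s : ∀ i, F.functor.obj (op (c i)), F.Compatible c s →
    ∃! t : F.functor.obj (op (⨆ i, c i)), ∀ i, F.res (le_iSup c i) t = s i

lemma UniqueGluing.existsUnique {F : PSh Q} {I : Type u} {c : I → Q} (h : F.UniqueGluing c)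
    {w : Q} (hw : w = ⨆ i, c i) {s : ∀ i, F.functor.obj (op (c i))} (hs : F.Compatible c s) :
    ∃! t : F.functor.obj (op w), ∀ i, F.res ((le_iSup c i).trans hw.ge) t = s i := by
  subst hw
  exact h s hs

lemma IsSheaf.precomp {F : PSh Q} (hF : F.IsSheaf) {p : Q → Q} (hp : Monotone p)
    (hsup : ∀ (I : Type u) (c : I → Q), p (⨆ i, c i) = ⨆ i, p (c i))
    (hmul : ∀ a b, p a * p b ≤ p (a * b)) : (F.precomp hp).IsSheaf := by
  intro I c s hs
  have hcompat : F.Compatible (fun i => p (c i)) s := fun i j => by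
    have := congrArg (F.res (hmul (c i) (c j))) (hs i j)
    exact (F.res_res _ _ _).symm.trans (this.trans (F.res_res _ _ _))
  exact UniqueGluing.existsUnique (hF I _) (hsup I c) hcompat

theorem IsSheaf.shift {F : PSh Q} (hF : F.IsSheaf) (q : Q) : (F.shift q).IsSheaf :=
  hF.precomp (p := fun a => q * a) (fun _ _ h => mul_le_mul_right h q)
    (fun _ _ => Quantale.mul_iSup_distrib) fun a b => calc
      q * a * (q * b) ≤ q * a * b := mul_le_mul_right (IsSemicartesian.mul_le_right q b) _
      _ = q * (a * b) := mul_assoc q a b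

theorem IsSheaf.shiftRight {F : PSh Q} (hF : F.IsSheaf) (q : Q) : (F.shiftRight q).IsSheaf :=
  hF.precomp (p := fun a => a * q) (fun _ _ h => mul_le_mul_left h q)
    (fun _ _ => Quantale.iSup_mul_distrib) fun a b => calc
      a * q * (b * q) ≤ a * (b * q) := mul_le_mul_left (IsSemicartesian.mul_le_left a q) _
      _ = a * b * q := (mul_assoc a b q).symm

lemma UniqueGluing.of_comp {F : PSh Q} {I J : Type u} {c : I → Q} {σ : J → I}
    (h : F.UniqueGluing (c ∘ σ)) (hσ : ∀ i, ∃ j, c (σ j) = c i)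
    (hF : ∀ u, Function.Injective (F.res (IsSemicartesian.mul_le_left u u))) :
    F.UniqueGluing c := by
  intro s hs
  have hs_eq (i k : I) (hik : c k = c i) : F.res hik.ge (s k) = s i := by
    apply hF (c i)
    have := congrArg (F.res (mul_le_mul_right hik.ge (c i))) (hs i k)
    rw [res_res, res_res] at this
    rw [res_res, this]
  have hsup : ⨆ i, c i = ⨆ j, c (σ j) :=
    le_antisymm (iSup_le fun i => (hσ i).elim fun j hj => hj ▸ le_iSup (fun j => c (σ j)) j)
      (iSup_comp_le c σ)
  obtain ⟨t, ht, ht_unique⟩ := h.existsUnique hsup (s := fun j => s (σ j)) fun i j => hs (σ i) (σ j)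
  refine ⟨t, fun i => ?_, fun t' ht' => ht_unique t' fun j => ht' (σ j)⟩
  obtain ⟨j, hj⟩ := hσ i
  rw [← hs_eq i (σ j) hj, ← ht j, res_res]

lemma UniqueGluing.injective_res {F : PSh Q} {I : Type u} [Nontrivial I] {u : Q}
    (h : F.UniqueGluing fun _ : I => u) :
    Function.Injective (F.res (IsSemicartesian.mul_le_left u u)) := by
  classical
  intro x y hxy
  obtain ⟨i, j, hij⟩ := exists_pair_ne I
  have hcompat : F.Compatible (fun _ : I => u) fun k => if k = i then x else y := by
    intro k l
    beta_reduce
    split_ifs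
    exacts [rfl, hxy, hxy.symm, rfl]
  obtain ⟨t, ht, -⟩ := h.existsUnique (haveI : Nonempty I := ⟨i⟩; iSup_const.symm) hcompat
  simpa [hij.symm] using (ht i).symm.trans (ht j)

/-- Repetitions in a cover only matter through the injectivity of the maps `F(u) ⟶ F(u ⊙ u)`. The
subsets of `Option Q` index every cover without repetitions, and as `Option Q` has two elements,
some constant family indexed by it detects this injectivity. -/
lemma isSheaf_iff_forall_set (F : PSh Q) :
    F.IsSheaf ↔ ∀ (S : Set (Option Q)) (c : S → Q), F.UniqueGluing c := by
  refine ⟨fun hF S c => hF S c, fun h I c => ?_⟩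
  have members (x : some '' Set.range c) : ∃ i, some (c i) = x.1 := by
    obtain ⟨_, _, ⟨i, rfl⟩, rfl⟩ := x
    exact ⟨i, rfl⟩
  choose σ hσ using members
  have : Nontrivial (Set.univ : Set (Option Q)) := Set.nontrivial_univ.coe_sort
  refine (h _ (c ∘ σ)).of_comp (fun i => ?_) fun u => (h Set.univ fun _ => u).injective_res
  exact ⟨⟨some (c i), c i, ⟨i, rfl⟩, rfl⟩, Option.some_injective _ (hσ _)⟩

lemma Compatible.map_hom {F G : PSh Q} {I : Type u} {c : I → Q}
    {s : ∀ i, F.functor.obj (op (c i))} (hs : F.Compatible c s) (f : F ⟶ G) :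
    G.Compatible c fun i => f.natTrans.app (op (c i)) (s i) := fun i j => by
  rw [← hom_res, ← hom_res, hs i j]

variable {I : Type u} (c : I → Q)

lemma compatible_coverSection : (coverPresheaf c).Compatible c (coverSection c) :=
  fun _ _ => Quot.sound le_rfl

/-- Morphisms out of the presheaf generated by a cover are compatible families. -/
def coverPresheafHomEquiv (F : PSh Q) :
    (coverPresheaf c ⟶ F) ≃ {s : ∀ i, F.functor.obj (op (c i)) // F.Compatible c s} where
  toFun f := ⟨_, (compatible_coverSection c).map_hom f⟩
  invFun s := ⟨{
    app w := TypeCat.ofHom (Quot.lift (fun i => F.res i.2 (s.1 i)) fun i j h => by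
      simpa only [res_res] using congrArg (F.res h) (s.2 i j))
    naturality _ _ _ := by
      ext ⟨_⟩
      exact (F.res_res _ _ _).symm }⟩
  left_inv f := by
    ext w ⟨i⟩
    exact (hom_res f i.2 _).symm
  right_inv s := Subtype.ext (funext fun i => Functor.map_id_apply F.functor _ (s.1 i))

/-- The compatible family of restrictions of a section over the join of a cover. -/
def restrictCover (F : PSh Q) (t : F.functor.obj (op (⨆ i, c i))) :
    {s : ∀ i, F.functor.obj (op (c i)) // F.Compatible c s} :=
  ⟨fun i => F.res (le_iSup c i) t, fun i j => by rw [res_res, res_res]⟩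

lemma uniqueGluing_iff_bijective_restrictCover (F : PSh Q) :
    F.UniqueGluing c ↔ Function.Bijective (F.restrictCover c) := by
  simp only [Function.bijective_iff_existsUnique, Subtype.forall, UniqueGluing, Subtype.ext_iff,
    funext_iff]
  rfl

lemma coverPresheafHomEquiv_coverMap_comp (F : PSh Q) (f : (⟨yoneda.obj (⨆ i, c i)⟩ : PSh Q) ⟶ F) :
    coverPresheafHomEquiv c F (coverMap c ≫ f) = F.restrictCover c (yonedaHomEquiv F _ f) :=
  Subtype.ext (funext fun i => hom_res f (le_iSup c i) (𝟙 _))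

lemma bijective_coverMap_comp_iff (F : PSh Q) :
    Function.Bijective (fun f : (⟨yoneda.obj (⨆ i, c i)⟩ : PSh Q) ⟶ F => coverMap c ≫ f) ↔
      F.UniqueGluing c := by
  rw [uniqueGluing_iff_bijective_restrictCover, ← (yonedaHomEquiv F _).bijective_comp,
    ← (coverPresheafHomEquiv c F).comp_bijective]
  exact iff_of_eq (congrArg _ (funext (coverPresheafHomEquiv_coverMap_comp c F)))

variable (Q) in
lemma isSheaf_eq_isLocal_coverMap :
    IsSheaf (Q := Q) = (MorphismProperty.ofHoms
      fun c : Σ S : Set (Option Q), S → Q => coverMap c.2).isLocal := by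
  ext F
  simp only [isSheaf_iff_forall_set, ← bijective_coverMap_comp_iff]
  constructor
  · rintro h _ _ _ ⟨S, c⟩
    exact h S c
  · exact fun h S c => h _ (.mk (⟨S, c⟩ : Σ S : Set (Option Q), S → Q))

end PSh

theorem isMonoidal_inverseImage_isomorphisms_of_sheafification {Q : Type u} [Monoid Q]
    [CompleteLattice Q] [IsQuantale Q] [IsSemicartesian Q] {a : PSh Q ⥤ Sh Q}
    (adj : a ⊣ shInclusion Q) :
    ((MorphismProperty.isomorphisms (Sh Q)).inverseImage a).IsMonoidal := by
  rw [← ObjectProperty.isLocal_eq_inverseImage_isomorphisms adj]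
  refine isMonoidal_isLocal_of_shift _ ?_ ?_
  · rintro _ ⟨Z, rfl⟩ u
    exact ⟨⟨_, Z.property.shift u.unop⟩, rfl⟩
  · rintro _ ⟨Z, rfl⟩ v
    exact ⟨⟨_, Z.property.shiftRight v.unop⟩, rfl⟩

theorem isRightAdjoint_shInclusion (Q : Type u) [Monoid Q] [CompleteLattice Q] [IsQuantale Q]
    [IsSemicartesian Q] : (shInclusion Q).IsRightAdjoint := by
  have : IsLocallyPresentable.{u} (PSh Q) :=
    (DayFunctor.equiv Qᵒᵖ (Type u)).symm.isLocallyPresentable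
  change (ObjectProperty.ι (PSh.IsSheaf (Q := Q))).IsRightAdjoint
  rw [PSh.isSheaf_eq_isLocal_coverMap]
  exact isRightAdjoint_ι_isLocal_ofHoms _

end Sheaves

end

theorem mainTheorem6 (Q : Type u) [Monoid Q] [CompleteLattice Q] [IsQuantale Q]
    [IsSemicartesian Q] :
    (∀ (F : PSh Q) (q : Q), F.IsSheaf → (F.shift q).IsSheaf) ∧
    (shInclusion Q).IsRightAdjoint ∧
    Nonempty (MonoidalClosed (PSh Q)) ∧
    ∀ [MonoidalClosed (PSh Q)] (a : PSh Q ⥤ Sh Q) (adj : a ⊣ shInclusion Q),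
      (∃ (N : NormalEnrichment adj)
        (h : ∀ F G : Sh Q, N.tensor F G =
          a.obj ((shInclusion Q).obj F ⊗ (shInclusion Q).obj G)),
        ∀ F G : Sh Q, N.fromReflection F G = eqToHom (h F G).symm) ∧
      ∀ N N' : NormalEnrichment adj, N.Equiv N' := by
  refine ⟨fun F q hF => hF.shift q, isRightAdjoint_shInclusion Q, ⟨dayMonoidalClosed⟩, ?_⟩
  intro _ a adj
  have := isMonoidal_inverseImage_isomorphisms_of_sheafification adj
  exact ⟨exists_normalEnrichment_of_isMonoidal adj, fun N N' => N.equiv N'⟩
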